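/- Let $T>0$, $I=[0,T]$, and let $\mathbb T^2=(\mathbb R/\mathbb Z)^2$. Let $n\geq 3$ be odd and let $$F(t,y)=\sum_{j=0}^n A_j(t)\,y^j ,$$ where $A_0,\dots,A_n:I\to\mathbb R$ are of class $C^1$ and $A_n(t)<0$ for all $t\in I$. Assume that there is a continuous map $\phi^*:I\to\mathbb R$ with $F(t,\phi^*(t))=0$ for all $t\in I$, and constants $a_+>a_->0$ such that $$-a_+<\partial_y F(t,\phi^*(t))<-a_-\qquad\forall t\in I .$$ Then there exist constants $\varepsilon_0,C>0$ such that, for every $\varepsilon\in(0,\varepsilon_0)$, the equation $$\partial_t\phi(t,x)=\frac1\varepsilon\bigl[\Delta\phi(t,x)+F(t,\phi(t,x))\bigr],\qquad t\in I,\ x\in\mathbb T^2,$$ admits a real-valued classical solution $\bar\phi$ on $I\times\mathbb T^2$ (that is, $\partial_t\bar\phi$ and all spatial derivatives of $\bar\phi$ of order at most two exist and are continuous on $I\times\mathbb T^2$, time derivatives being one-sided at the end points of $I$) satisfying $$\|\bar\phi(t,\cdot)-\phi^*(t)\|_{H^1(\mathbb T^2)}\leq C\varepsilon\qquad\forall t\in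 I ,$$ where $\phi^*(t)$ is regarded as a constant function on $\mathbb T^2$ and $\|f\|_{H^1(\mathbb T^2)}^2=\|f\|_{L^2}^2+\|\nabla f\|_{L^2}^2=\sum_{k\in\mathbb Z^2}(1+4\pi^2|k|^2)\,|\hat f(k)|^2$, with $|k|$ the Euclidean norm and $\hat f(k)$ the Fourier coefficients of $f$. -/

import Mathlib

open MeasureTheory
open scoped ENNReal

noncomputable section

/-- The two-dimensional torus `(ℝ/ℤ)²`. -/
abbrev Torus2 : Type := UnitAddTorus (Fin 2)

/-- The `ℤ²`-periodic function on the plane that corresponds to a function on the torus.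
Spatial derivatives of `u` are by definition those of this function. -/
def periodicLift (u : Torus2 → ℝ) (x : EuclideanSpace ℝ (Fin 2)) : ℝ :=
  u fun i => (x i : UnitAddCircle)

/-- The polynomial `F(t, y) = ∑_{j=0}^n A_j(t) y^j`. -/
def forcing {n : ℕ} (A : Fin (n + 1) → ℝ → ℝ) (t y : ℝ) : ℝ :=
  ∑ j : Fin (n + 1), A j t * y ^ (j : ℕ)

/-- The `H¹` norm of a real function on the torus, as an extended nonnegative number:
`‖f‖² = ∑_k (1 + (2π)² |k|²) |f_k|² = ‖f‖²_{L²} + ‖∇f‖²_{L²}`, with `|k|` the Euclidean norm and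
`f_k` the Fourier coefficients; it is `∞` if `f` is not in `L²`. -/
def sobolevH1Norm (f : Torus2 → ℝ) : ℝ≥0∞ :=
  open Classical in
  if MemLp f 2 (volume : Measure Torus2) then
    (∑' k : Fin 2 → ℤ,
      ENNReal.ofReal (1 + (2 * Real.pi) ^ 2 * ((k 0 : ℝ) ^ 2 + (k 1 : ℝ) ^ 2)) *
        ‖UnitAddTorus.mFourierCoeff (fun x => (f x : ℂ)) k‖ₑ ^ 2) ^ (1 / 2 : ℝ)
  else ∞

/-- `φ` is a classical (`C^{1,2}`) solution of `∂_t φ = ε⁻¹ [Δφ + F(t, φ)]` on `[0, T] × (ℝ/ℤ)²`;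
the time derivative is one-sided at `t = 0` and `t = T`. Continuity of the time derivative
follows from the equation when `F` is continuous. -/
structure IsClassicalSolution (T ε : ℝ) (F : ℝ → ℝ → ℝ) (φ : ℝ → Torus2 → ℝ) : Prop where
  contDiff_space : ∀ t ∈ Set.Icc 0 T, ContDiff ℝ 2 (periodicLift (φ t))
  continuousOn_deriv : ∀ m ≤ 2, ContinuousOn
    (fun p : ℝ × EuclideanSpace ℝ (Fin 2) => iteratedFDeriv ℝ m (periodicLift (φ p.1)) p.2)
    (Set.Icc 0 T ×ˢ Set.univ)
  equation : ∀ t ∈ Set.Icc 0 T, ∀ x : EuclideanSpace ℝ (Fin 2),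
    HasDerivWithinAt (fun s => periodicLift (φ s) x)
      (ε⁻¹ * (Laplacian.laplacian (periodicLift (φ t)) x + F t (periodicLift (φ t) x)))
      (Set.Icc 0 T) t

end

/-! The branch does not depend on `x`, so a spatially constant solution suffices: the Laplacian
drops out, the `H¹` error is an absolute value, and what remains is the slow-fast equation `ε y' =
F(t, y)` with `y 0 = φstar 0`. By compactness, `∂_y F ≤ -am / 2` on a tube of fixed radius `r`
around the branch. This makes the branch Lipschitz at small scales (`abs_sub_le_of_zero_branch`),
with constant `K`. At distance `C * ε` from it, the field pulls `y` back at speed at least `(am / 2)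
* C`, independently of `ε`. If this exceeds `K`, `y` cannot leave the tube of radius `C * ε`
(`exists_solution_tracking_zero`). -/

/-- Lipschitz in space vector fields near a moving zero which are contracting there have solutions
that track the zero at distance `C * ε`. -/
theorem exists_solution_tracking_zero {T r m M K C ε δ : ℝ} {f : ℝ → ℝ → ℝ} {φ : ℝ → ℝ}
    (hT : 0 < T) (hε : 0 < ε) (hM : 0 ≤ M) (hC : 0 < C) (hr : C * ε ≤ r) (hK : K < m * C)
    (hδ : 0 < δ)
    (hf : ContinuousOn (fun p : ℝ × ℝ => f p.1 p.2) (Set.Icc 0 T ×ˢ Set.univ))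
    (hφ : ContinuousOn φ (Set.Icc 0 T))
    (hφK : ∀ s ∈ Set.Icc 0 T, ∀ t ∈ Set.Icc 0 T, |s - t| < δ → |φ s - φ t| ≤ K * |s - t|)
    (hzero : ∀ t ∈ Set.Icc 0 T, f t (φ t) = 0)
    (hcontr : ∀ t ∈ Set.Icc 0 T, ∀ u ∈ Set.Icc (-r) r, ∀ v ∈ Set.Icc (-r) r, u ≤ v →
      f t (φ t + v) - f t (φ t + u) ≤ -m * (v - u))
    (hlip : ∀ t ∈ Set.Icc 0 T, ∀ u ∈ Set.Icc (-r) r, ∀ v ∈ Set.Icc (-r) r,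
      |f t (φ t + v) - f t (φ t + u)| ≤ M * |v - u|) :
    ∃ y : ℝ → ℝ,
      (∀ t ∈ Set.Icc 0 T, HasDerivWithinAt y (ε⁻¹ * f t (y t)) (Set.Icc 0 T) t) ∧
      ∀ t ∈ Set.Icc 0 T, |y t - φ t| ≤ C * ε := by
  have hCε : 0 < C * ε := mul_pos hC hε
  have hr0 : 0 < r := hCε.trans_le hr
  -- Truncating the displacement from the branch makes the field bounded and Lipschitz for all `x`,
  -- so one application of Picard–Lindelöf covers all of `[0, T]`.
  set c : ℝ → ℝ := fun w => max (-r) (min r w) with hc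
  have hcmem : ∀ w, c w ∈ Set.Icc (-r) r := fun w =>
    ⟨le_max_left _ _, max_le (by linarith) (min_le_left _ _)⟩
  have hcid : ∀ w ∈ Set.Icc (-r) r, c w = w := fun w hw => by
    simp [hc, hw.1, hw.2]
  have hclip : ∀ u v, |c v - c u| ≤ |v - u| := fun u v =>
    (abs_max_sub_max_le_max _ _ _ _).trans <| max_le (by simp) <|
      (abs_min_sub_min_le_max _ _ _ _).trans <| max_le (by simp) le_rfl
  have hccont : Continuous c := by fun_prop
  have h0r : (0 : ℝ) ∈ Set.Icc (-r) r := ⟨by linarith, hr0.le⟩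
  set G : ℝ → ℝ → ℝ := fun t x => ε⁻¹ * f t (φ t + c (x - φ t)) with hG
  have hε' : 0 ≤ ε⁻¹ := (inv_pos.2 hε).le
  have hbound : ∀ t ∈ Set.Icc 0 T, ∀ x, |G t x| ≤ ε⁻¹ * (M * r) := by
    intro t ht x
    have h := hlip t ht 0 h0r _ (hcmem (x - φ t))
    rw [add_zero, hzero t ht, sub_zero, sub_zero] at h
    rw [hG, abs_mul, abs_of_nonneg hε']
    exact mul_le_mul_of_nonneg_left
      (h.trans (mul_le_mul_of_nonneg_left (abs_le.2 (hcmem _)) hM)) hε'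
  have hpl : IsPicardLindelof G (tmin := 0) (tmax := T) ⟨0, le_rfl, hT.le⟩ (φ 0)
      (.mk (ε⁻¹ * (M * r) * T) (by positivity)) 0 (.mk (ε⁻¹ * (M * r)) (by positivity))
      (.mk (ε⁻¹ * M) (by positivity)) := by
    refine ⟨fun t ht => ?_, fun x _ => ?_, fun t ht x _ => hbound t ht x, ?_⟩
    · refine LipschitzOnWith.of_dist_le_mul fun x _ y _ => ?_
      rw [Real.dist_eq, Real.dist_eq, hG, ← mul_sub, abs_mul, abs_of_nonneg hε', NNReal.coe_mk,
        mul_assoc]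
      refine mul_le_mul_of_nonneg_left ((hlip t ht _ (hcmem _) _ (hcmem _)).trans
        (mul_le_mul_of_nonneg_left ((hclip _ _).trans ?_) hM)) hε'
      simp
    · refine continuousOn_const.mul (hf.comp (f := fun t => (t, φ t + c (x - φ t)))
        (continuousOn_id.prodMk ?_) fun t ht => ⟨ht, trivial⟩)
      exact hφ.add (hccont.comp_continuousOn (continuousOn_const.sub hφ))
    · simp [hT.le]
  obtain ⟨y, hy0, hy⟩ := hpl.exists_eq_forall_mem_Icc_hasDerivWithinAt₀
  have hycont : ContinuousOn y (Set.Icc 0 T) := fun t ht => (hy t ht).continuousWithinAt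
  have hnear : ∀ x ∈ Set.Ico 0 T, ∀ᶠ z in nhdsWithin x (Set.Ioi x),
      x < z ∧ z ∈ Set.Icc 0 T ∧ |z - x| < δ := by
    intro x hx
    have h : Set.Ioo x (min T (x + δ)) ∈ nhdsWithin x (Set.Ioi x) :=
      Ioo_mem_nhdsGT (lt_min hx.2 (by linarith))
    filter_upwards [h] with z hz
    have h1 := hz.2.trans_le (min_le_left _ _)
    have h2 := hz.2.trans_le (min_le_right _ _)
    exact ⟨hz.1, ⟨hx.1.trans hz.1.le, h1.le⟩, by rw [abs_of_pos (sub_pos.2 hz.1)]; linarith⟩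
  have hslope : ∀ x ∈ Set.Ico 0 T, Filter.Tendsto (slope y x) (nhdsWithin x (Set.Ioi x))
      (nhds (G x (y x))) := by
    intro x hx
    have h := hasDerivWithinAt_iff_tendsto_slope.1 (hy x ⟨hx.1, hx.2.le⟩)
    refine h.mono_left (nhdsWithin_le_iff.2 ?_)
    filter_upwards [hnear x hx] with z hz
    exact ⟨hz.2.1, hz.1.ne'⟩
  have hφslope : ∀ x ∈ Set.Ico 0 T, ∀ᶠ z in nhdsWithin x (Set.Ioi x), |slope φ x z| ≤ K := by
    intro x hx
    filter_upwards [hnear x hx] with z hz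
    rw [slope_def_field, abs_div, div_le_iff₀ (abs_pos.2 (sub_ne_zero.2 hz.1.ne'))]
    exact hφK z hz.2.1 x ⟨hx.1, hx.2.le⟩ hz.2.2
  have hCr : C * ε ∈ Set.Icc (-r) r := ⟨by linarith, hr⟩
  have hCr' : -(C * ε) ∈ Set.Icc (-r) r := ⟨by linarith, by linarith⟩
  have hfield : ε⁻¹ * (m * (C * ε)) = m * C := by field_simp
  -- Barrier argument: at contact `y` has slope at most `-m * C`, while the slopes of `φ` are at
  -- least `-K`. Right slopes are used because `φ` need not be known to be differentiable.
  have hupper : ∀ t ∈ Set.Icc 0 T, y t - φ t ≤ C * ε := by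
    refine image_le_of_liminf_slope_right_lt_deriv_boundary (B := fun _ => C * ε)
      (B' := fun _ => 0) (f' := fun x => G x (y x) + K) (hycont.fun_sub hφ) ?_
      (by simp [hy0, hCε.le]) (fun x => hasDerivAt_const x _) ?_
    · intro x hx b hb
      refine Filter.Eventually.frequently ?_
      filter_upwards [(hslope x hx).eventually_lt_const (show G x (y x) < b - K by linarith),
        hφslope x hx] with z h1 h2
      have : slope (fun t => y t - φ t) x z = slope y x z - slope φ x z := by
        simp only [slope_def_field]; ring
      rw [this]
      linarith [(abs_le.1 h2).1]
    · intro x hx hxe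
      have hx' : x ∈ Set.Icc 0 T := ⟨hx.1, hx.2.le⟩
      have h := hcontr x hx' 0 h0r _ hCr hCε.le
      rw [add_zero, hzero x hx', sub_zero, sub_zero] at h
      have h' := mul_le_mul_of_nonneg_left h hε'
      simp only [hG, hxe, hcid _ hCr]
      linarith
  have hlower : ∀ t ∈ Set.Icc 0 T, φ t - y t ≤ C * ε := by
    refine image_le_of_liminf_slope_right_lt_deriv_boundary (B := fun _ => C * ε)
      (B' := fun _ => 0) (f' := fun x => -G x (y x) + K) (hφ.fun_sub hycont) ?_
      (by simp [hy0, hCε.le]) (fun x => hasDerivAt_const x _) ?_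
    · intro x hx b hb
      refine Filter.Eventually.frequently ?_
      filter_upwards [(hslope x hx).eventually_const_lt (show K - b < G x (y x) by linarith),
        hφslope x hx] with z h1 h2
      have : slope (fun t => φ t - y t) x z = slope φ x z - slope y x z := by
        simp only [slope_def_field]; ring
      rw [this]
      linarith [(abs_le.1 h2).2]
    · intro x hx hxe
      have hx' : x ∈ Set.Icc 0 T := ⟨hx.1, hx.2.le⟩
      have h := hcontr x hx' _ hCr' 0 h0r (by linarith)
      rw [add_zero, hzero x hx', zero_sub, zero_sub, neg_neg] at h
      have h' := mul_le_mul_of_nonneg_left h hε'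
      have hxe' : y x - φ x = -(C * ε) := by linarith
      simp only [hG, hxe', hcid _ hCr']
      linarith
  -- The trapped solution never meets the truncation, so it solves the original equation.
  refine ⟨y, fun t ht => ?_, fun t ht => abs_le.2 ⟨by linarith [hlower t ht], hupper t ht⟩⟩
  have h := hy t ht
  have hmem : y t - φ t ∈ Set.Icc (-r) r :=
    ⟨by linarith [hlower t ht], by linarith [hupper t ht]⟩
  simp only [hG, hcid _ hmem, add_sub_cancel] at h
  exact h

/-- A continuous branch of zeros of a function that is strictly decreasing at a uniform rate near
the branch, and Lipschitz in time, is Lipschitz on a small scale. -/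
theorem abs_sub_le_of_zero_branch {T r m L : ℝ} {f : ℝ → ℝ → ℝ} {φ : ℝ → ℝ}
    (hr : 0 < r) (hm : 0 < m) (hφ : ContinuousOn φ (Set.Icc 0 T))
    (hzero : ∀ t ∈ Set.Icc 0 T, f t (φ t) = 0)
    (hcontr : ∀ t ∈ Set.Icc 0 T, ∀ u ∈ Set.Icc (-r) r, ∀ v ∈ Set.Icc (-r) r, u ≤ v →
      f t (φ t + v) - f t (φ t + u) ≤ -m * (v - u))
    (hlip : ∀ s ∈ Set.Icc 0 T, ∀ t ∈ Set.Icc 0 T, |f s (φ s) - f t (φ s)| ≤ L * |s - t|) :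
    ∃ δ, 0 < δ ∧ ∀ s ∈ Set.Icc 0 T, ∀ t ∈ Set.Icc 0 T, |s - t| < δ →
      |φ s - φ t| ≤ L / m * |s - t| := by
  -- For close times `φ s` lies in the tube around `φ t`, where monotonicity of `f t` turns the
  -- smallness of `f t (φ s)` into that of `φ s - φ t`.
  obtain ⟨δ, hδ, h⟩ := Metric.uniformContinuousOn_iff.1
    (isCompact_Icc.uniformContinuousOn_of_continuous hφ) r hr
  refine ⟨δ, hδ, fun s hs t ht hst => ?_⟩
  have hd := abs_lt.1 (h s hs t ht hst)
  have hw : φ s - φ t ∈ Set.Icc (-r) r := ⟨hd.1.le, hd.2.le⟩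
  have h0 : (0 : ℝ) ∈ Set.Icc (-r) r := ⟨by linarith, hr.le⟩
  have hl := hlip s hs t ht
  rw [hzero s hs, zero_sub, abs_neg] at hl
  have hl' := abs_le.1 hl
  rw [div_mul_eq_mul_div, le_div_iff₀ hm]
  rcases le_total 0 (φ s - φ t) with h1 | h1
  · have := hcontr t ht 0 h0 _ hw h1
    rw [add_zero, hzero t ht, add_sub_cancel] at this
    rw [abs_of_nonneg h1]; linarith
  · have := hcontr t ht _ hw 0 h0 h1
    rw [add_zero, hzero t ht, add_sub_cancel] at this
    rw [abs_of_nonpos h1]; linarith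

/-- The only nonzero Fourier coefficient of a constant is the one of index zero. -/
theorem mFourierCoeff_const (c : ℂ) (k : Fin 2 → ℤ) :
    UnitAddTorus.mFourierCoeff (fun _ : Torus2 => c) k = if k = 0 then c else 0 := by
  have h1 : UnitAddTorus.mFourierCoeff (fun _ : Torus2 => c) k =
      c * inner ℂ (UnitAddTorus.mFourierLp (d := Fin 2) 2 k) (UnitAddTorus.mFourierLp 2 0) := by
    simp only [ContinuousMap.inner_toLp, ← UnitAddTorus.mFourier_neg, UnitAddTorus.mFourier_zero,
      UnitAddTorus.mFourierCoeff, smul_eq_mul, integral_mul_const, ContinuousMap.one_apply, one_mul,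
      mul_comm c]
  rw [h1, orthonormal_iff_ite.1 UnitAddTorus.orthonormal_mFourier]
  simp

theorem sobolevH1Norm_const (c : ℝ) :
    sobolevH1Norm (fun _ : Torus2 => c) = ENNReal.ofReal |c| := by
  have hmem : MemLp (fun _ : Torus2 => c) 2 (volume : Measure Torus2) := memLp_const c
  rw [sobolevH1Norm, if_pos hmem, tsum_eq_single 0]
  · rw [mFourierCoeff_const, if_pos rfl]
    simp only [Pi.zero_apply, Int.cast_zero]
    rw [← ENNReal.rpow_natCast, ENNReal.mul_rpow_of_nonneg _ _ (by norm_num), ← ENNReal.rpow_mul]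
    simp [← ofReal_norm]
  · intro k hk
    simp [mFourierCoeff_const, hk]

/-- Since the Laplacian of a constant vanishes, a solution of the ordinary differential equation
`ε y' = F(t, y)` is a classical solution of the reaction-diffusion equation. -/
theorem isClassicalSolution_of_ode {T ε : ℝ} {F : ℝ → ℝ → ℝ} {y : ℝ → ℝ}
    (hy : ∀ t ∈ Set.Icc 0 T, HasDerivWithinAt y (ε⁻¹ * F t (y t)) (Set.Icc 0 T) t) :
    IsClassicalSolution T ε F fun t _ => y t := by
  have hlift : ∀ t, periodicLift (fun _ => y t) = fun _ => y t := fun t => rfl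
  have hycont : ContinuousOn y (Set.Icc 0 T) := fun t ht => (hy t ht).continuousWithinAt
  refine ⟨fun t _ => contDiff_const, fun k _ => ?_, fun t ht x => ?_⟩
  · simp only [hlift]
    rcases eq_or_ne k 0 with rfl | hk
    · simp only [iteratedFDeriv_zero_eq_comp, Function.comp_def]
      exact (LinearIsometryEquiv.continuous _).comp_continuousOn
        (hycont.comp continuousOn_fst fun p hp => hp.1)
    · simp only [iteratedFDeriv_const_of_ne hk]
      exact continuousOn_const
  · simp only [hlift]
    simpa using hy t ht

theorem hasDerivAt_forcing {n : ℕ} (A : Fin (n + 1) → ℝ → ℝ) (t y : ℝ) :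
    HasDerivAt (fun y => forcing A t y)
      (∑ j : Fin (n + 1), A j t * ((j : ℕ) * y ^ ((j : ℕ) - 1))) y := by
  unfold forcing
  exact HasDerivAt.fun_sum fun j _ => (hasDerivAt_pow _ _).const_mul _

/-- The solution is homogeneous in space, like the equilibrium branch that it tracks: it is the
solution of `ε y' = F(t, y)` that starts on the branch. Neither the sign of the leading coefficient
nor the parity of the degree is needed for it, as it never leaves a tube around the branch. -/
theorem proposition2p5
    (T : ℝ) (hT : 0 < T)
    (n : ℕ) (hn : 3 ≤ n) (hodd : Odd n)
    (A : Fin (n + 1) → ℝ → ℝ)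
    (hA : ∀ j, ContDiffOn ℝ 1 (A j) (Set.Icc 0 T))
    (hlead : ∀ t ∈ Set.Icc 0 T, A (Fin.last n) t < 0)
    (φstar : ℝ → ℝ) (hcont : ContinuousOn φstar (Set.Icc 0 T))
    (hzero : ∀ t ∈ Set.Icc 0 T, forcing A t (φstar t) = 0)
    (am ap : ℝ) (ham : 0 < am) (hap : am < ap)
    (hstable : ∀ t ∈ Set.Icc 0 T,
      -ap < deriv (fun y => forcing A t y) (φstar t) ∧
        deriv (fun y => forcing A t y) (φstar t) < -am) :
    ∃ ε₀ : ℝ, 0 < ε₀ ∧ ∃ C : ℝ, 0 < C ∧ ∀ ε : ℝ, 0 < ε → ε < ε₀ →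
      ∃ φbar : ℝ → Torus2 → ℝ,
        IsClassicalSolution T ε (forcing A) φbar ∧
        ∀ t ∈ Set.Icc 0 T,
          sobolevH1Norm (fun x => φbar t x - φstar t) ≤ ENNReal.ofReal (C * ε) := by
  have hAc : ∀ j, ContinuousOn (fun p : ℝ × ℝ => A j p.1) (Set.Icc 0 T ×ˢ Set.univ) := fun j =>
    (hA j).continuousOn.comp continuousOn_fst fun p hp => hp.1
  have hF : ContinuousOn (fun p : ℝ × ℝ => forcing A p.1 p.2) (Set.Icc 0 T ×ˢ Set.univ) :=
    continuousOn_finsetSum _ fun j _ => (hAc j).mul (continuous_snd.pow _).continuousOn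
  have hD : ContinuousOn (fun p : ℝ × ℝ => deriv (fun y => forcing A p.1 y) p.2)
      (Set.Icc 0 T ×ˢ Set.univ) := by
    simp only [(hasDerivAt_forcing A _ _).deriv]
    exact continuousOn_finsetSum _ fun j _ =>
      (hAc j).mul (continuous_const.mul (continuous_snd.pow _)).continuousOn
  have hdiff : ∀ t, Differentiable ℝ (fun y => forcing A t y) := fun t y =>
    (hasDerivAt_forcing A t y).differentiableAt
  have hE : ContinuousOn (fun p : ℝ × ℝ => deriv (fun y => forcing A p.1 y) (φstar p.1 + p.2))
      (Set.Icc 0 T ×ˢ Set.Icc (-1) 1) := by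
    refine hD.comp (f := fun p : ℝ × ℝ => (p.1, φstar p.1 + p.2)) (continuousOn_fst.prodMk
      ((hcont.comp continuousOn_fst fun p hp => hp.1).add continuousOn_snd)) fun p hp =>
        ⟨hp.1, trivial⟩
  have hcomp : IsCompact (Set.Icc 0 T ×ˢ Set.Icc (-1 : ℝ) 1) := isCompact_Icc.prod isCompact_Icc
  obtain ⟨M, hM⟩ := hcomp.exists_bound_of_continuousOn hE
  -- Half of the stability margin `am` is given up to get a tube radius uniform in `t`.
  obtain ⟨δ₁, hδ₁, hunif⟩ := Metric.uniformContinuousOn_iff.1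
    (hcomp.uniformContinuousOn_of_continuous hE) (am / 2) (by linarith)
  obtain ⟨r, hr0, hr1, hrδ⟩ : ∃ r, 0 < r ∧ r ≤ 1 ∧ r < δ₁ :=
    ⟨min 1 (δ₁ / 2), by positivity, min_le_left _ _, (min_le_right _ _).trans_lt (by linarith)⟩
  have hball : ∀ t w, w ∈ Set.Icc (-r) r → t ∈ Set.Icc 0 T →
      (t, w) ∈ Set.Icc 0 T ×ˢ Set.Icc (-1 : ℝ) 1 := fun t w hw ht =>
    ⟨ht, by linarith [hw.1], by linarith [hw.2]⟩
  have hneg : ∀ t ∈ Set.Icc 0 T, ∀ w ∈ Set.Icc (-r) r,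
      deriv (fun y => forcing A t y) (φstar t + w) ≤ -(am / 2) := by
    intro t ht w hw
    have h := hunif (t, w) (hball t w hw ht) (t, 0) (hball t 0 ⟨by linarith, hr0.le⟩ ht) (by
      rw [Prod.dist_eq, dist_self, Real.dist_eq, sub_zero]
      exact max_lt hδ₁ ((abs_le.2 hw).trans_lt hrδ))
    rw [Real.dist_eq] at h
    simp only [add_zero] at h
    linarith [(abs_lt.1 h).2, (hstable t ht).2]
  have hshift : ∀ t w, w ∈ Set.Icc (φstar t - r) (φstar t + r) →
      ∃ u ∈ Set.Icc (-r) r, w = φstar t + u := fun t w hw =>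
    ⟨w - φstar t, ⟨by linarith [hw.1], by linarith [hw.2]⟩, by ring⟩
  have hshift' : ∀ t, ∀ u ∈ Set.Icc (-r) r, φstar t + u ∈ Set.Icc (φstar t - r) (φstar t + r) :=
    fun t u hu => ⟨by linarith [hu.1], by linarith [hu.2]⟩
  have hcontr : ∀ t ∈ Set.Icc 0 T, ∀ u ∈ Set.Icc (-r) r, ∀ v ∈ Set.Icc (-r) r, u ≤ v →
      forcing A t (φstar t + v) - forcing A t (φstar t + u) ≤ -(am / 2) * (v - u) := by
    intro t ht u hu v hv huv
    have h := (convex_Icc (φstar t - r) (φstar t + r)).image_sub_le_mul_sub_of_deriv_le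
      (hdiff t).continuous.continuousOn (hdiff t).differentiableOn (C := -(am / 2)) (fun x hx => by
        obtain ⟨w, hw, rfl⟩ := hshift t x (interior_subset hx)
        exact hneg t ht w hw) _ (hshift' t u hu) _ (hshift' t v hv) (by linarith)
    rwa [add_sub_add_left_eq_sub] at h
  have hlip : ∀ t ∈ Set.Icc 0 T, ∀ u ∈ Set.Icc (-r) r, ∀ v ∈ Set.Icc (-r) r,
      |forcing A t (φstar t + v) - forcing A t (φstar t + u)| ≤ M * |v - u| := by
    intro t ht u hu v hv
    have h := (convex_Icc (φstar t - r) (φstar t + r)).norm_image_sub_le_of_norm_deriv_le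
      (fun x _ => hdiff t x) (fun x hx => by
        obtain ⟨w, hw, rfl⟩ := hshift t x hx
        exact hM (t, w) (hball t w hw ht)) (hshift' t u hu) (hshift' t v hv)
    rwa [add_sub_add_left_eq_sub] at h
  have hM0 : 0 ≤ M := (norm_nonneg _).trans (hM (0, 0) ⟨⟨le_rfl, hT.le⟩, by norm_num, by norm_num⟩)
  have hAL : ∀ j, ∃ κ : NNReal, LipschitzOnWith κ (A j) (Set.Icc 0 T) := fun j =>
    (hA j).exists_lipschitzOnWith one_ne_zero (convex_Icc 0 T) isCompact_Icc
  choose κ hκ using hAL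
  obtain ⟨R, hR⟩ := isCompact_Icc.exists_bound_of_continuousOn hcont
  have hR0 : 0 ≤ R := (norm_nonneg _).trans (hR 0 ⟨le_rfl, hT.le⟩)
  obtain ⟨δ, hδ, hbranch⟩ := abs_sub_le_of_zero_branch (L := ∑ j, κ j * R ^ (j : ℕ)) hr0
    (half_pos ham) hcont hzero hcontr (fun s hs t ht => by
      rw [forcing, forcing, ← Finset.sum_sub_distrib, Finset.sum_mul]
      refine (Finset.abs_sum_le_sum_abs _ _).trans (Finset.sum_le_sum fun j _ => ?_)
      rw [← sub_mul, abs_mul, abs_pow, mul_right_comm]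
      exact mul_le_mul ((hκ j).dist_le_mul s hs t ht)
        (pow_le_pow_left₀ (abs_nonneg _) (hR s hs) _) (by positivity) (by positivity))
  set K := (∑ j, κ j * R ^ (j : ℕ)) / (am / 2) with hKdef
  have hK0 : 0 ≤ K := by positivity
  have hC : 0 < (K + 1) / (am / 2) := by positivity
  -- This `C` gives `(am / 2) * C = K + 1 > K`, and `ε < r / C` keeps the barrier inside the tube of
  -- radius `r`.
  refine ⟨r / ((K + 1) / (am / 2)), by positivity, (K + 1) / (am / 2), hC, fun ε hε hεlt => ?_⟩
  obtain ⟨y, hy, hyb⟩ := exists_solution_tracking_zero hT hε hM0 hC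
    (by rw [lt_div_iff₀ hC] at hεlt; linarith) (by rw [mul_div_cancel₀]; linarith; linarith) hδ
    hF hcont hbranch hzero hcontr hlip
  refine ⟨fun t _ => y t, isClassicalSolution_of_ode hy, fun t ht => ?_⟩
  rw [sobolevH1Norm_const]
  exact ENNReal.ofReal_le_ofReal (hyb t ht)
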